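/- Let $\mathcal X\subset\mathbb R^d$ be compact and let $Y=\{Y(s)\}_{s\in\mathcal X}$ be a non-negative stochastic process with continuous sample paths such that $\mathbb E\{Y(s)\}=1$ for all $s\in\mathcal X$ and $\mathbb E\{\sup_{s\in\mathcal X}Y(s)\}<\infty$. Let $\{\zeta_i\}_{i\ge1}$ be the points of a Poisson process on $(0,\infty)$ with intensity measure $\zeta^{-2}\,d\zeta$, and let $Y_1,Y_2,\ldots$ be independent copies of $Y$ (with continuous sample paths), independent of $(\zeta_i)_{i\ge1}$. Put $\varphi_i(s)=\zeta_iY_i(s)$ and $\eta(s)=\max_{i\ge1}\varphi_i(s)$, $s\in\mathcal X$. For $k\ge2$ and $s_1,\ldots,s_k\in\mathcal X$ define the extremal concurrence probability $$p(s_1,\ldots,s_k)=\mathbb P\bigl\{\text{for some }\ell\ge1:\ \eta(s_j)=\varphi_\ell(s_j),\ j=1,\ldots,k\bigr\}.$$ Then $$p(s_1,\ldots,s_k)=\mathbb E_Y\left(\left[\mathbb E_{\tilde Y}\left\{\max_{j=1,\ldots,k}\frac{\tilde Y(s_j)}{Y(s_j)}\right\}\right]^{-1}\right),$$ where $\tilde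 Y$ is an independent copy of $Y$, $\mathbb E_{\tilde Y}$ is the expectation with respect to $\tilde Y$ with $Y$ held fixed, and quotients and expectations are taken in $[0,\infty]$ with $a/0=\infty$ for $a>0$, $0/0=0$ and $1/\infty=0$. -/

import Mathlib

open MeasureTheory ProbabilityTheory
open scoped ENNReal

noncomputable section

namespace Concurrence

/-- The number of indices `i` for which the point `ζ i` lies in `A`, i.e. the mass which the
random counting measure `∑ i, δ_{ζ i}` gives to `A` (points are counted with multiplicity). -/
def pointCount {Ω E : Type*} (ζ : ℕ → Ω → E) (A : Set E) (ω : Ω) : ℕ∞ :=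
  {i : ℕ | ζ i ω ∈ A}.encard

/-- The random points `ζ 0, ζ 1, …` (in an arbitrary measurable enumeration) are the points of a
Poisson process on `E` with intensity measure `μ`: the number of points in a measurable set `A` is
Poisson distributed with parameter `μ A` (and is almost surely infinite if `μ A = ∞`), and the
numbers of points in pairwise disjoint measurable sets are independent. -/
structure IsPoissonProcess {Ω E : Type*} [MeasurableSpace Ω] [MeasurableSpace E]
    (ζ : ℕ → Ω → E) (μ : Measure E) (P : Measure Ω) : Prop where
  measurable : ∀ i, Measurable (ζ i)
  poisson : ∀ A : Set E, MeasurableSet A → μ A ≠ ∞ →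
    ∀ n : ℕ, P {ω | pointCount ζ A ω = n} = poissonMeasure (μ A).toNNReal {n}
  infinite : ∀ A : Set E, MeasurableSet A → μ A = ∞ → ∀ᵐ ω ∂P, pointCount ζ A ω = ⊤
  indep : ∀ (m : ℕ) (A : Fin m → Set E), (∀ i, MeasurableSet (A i)) →
    Pairwise (fun i j => Disjoint (A i) (A j)) →
    iIndepFun (fun (i : Fin m) (ω : Ω) => pointCount ζ (A i) ω) P

/-- The measure `z⁻² dz` on `(0, ∞)`, as a measure on `ℝ`. -/
def inverseSquareMeasure : Measure ℝ :=
  (volume.restrict (Set.Ioi 0)).withDensity (fun z => ENNReal.ofReal ((z ^ 2)⁻¹))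

/-- A nonnegative stochastic process `Y` indexed by `T`, with continuous sample paths,
`E Y(s) = 1` for all `s`, and `E sup_s Y(s) < ∞`. -/
structure IsSpectralProcess {Ω T : Type*} [MeasurableSpace Ω] [TopologicalSpace T]
    (Y : Ω → T → ℝ) (P : Measure Ω) : Prop where
  measurable : ∀ s, Measurable (fun ω => Y ω s)
  nonneg : ∀ ω s, 0 ≤ Y ω s
  continuous : ∀ ω, Continuous (Y ω)
  mean_one : ∀ s, ∫ ω, Y ω s ∂P = 1
  sup_finite : ∫⁻ ω, ⨆ s, ENNReal.ofReal (Y ω s) ∂P < ∞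

/-- The ingredients of the spectral representation: `ζ 0, ζ 1, …` are the points of a Poisson
process on `(0, ∞)` with intensity `z⁻² dz`, and the `Ys i` are independent copies of the process
`Y` with continuous sample paths, independent of the points. Laws of processes are laws on the
product space `T → ℝ`, i.e. they are given by the finite-dimensional distributions. -/
structure IsSpectralRepresentation {Ω Ω' T : Type*} [MeasurableSpace Ω] [MeasurableSpace Ω']
    [TopologicalSpace T] (ζ : ℕ → Ω → ℝ) (Ys : ℕ → Ω → T → ℝ) (P : Measure Ω)
    (Y : Ω' → T → ℝ) (P' : Measure Ω') : Prop where
  poisson : IsPoissonProcess ζ inverseSquareMeasure P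
  spectral : ∀ i, IsSpectralProcess (Ys i) P
  identDistrib : ∀ i, IdentDistrib (Ys i) Y P P'
  iIndep : iIndepFun Ys P
  indep : IndepFun (fun ω i => ζ i ω) (fun ω i => Ys i ω) P

/-- The random functions `φ_i(s) = ζ_i Y_i(s)`. -/
def spectralFunction {Ω T : Type*} (ζ : ℕ → Ω → ℝ) (Ys : ℕ → Ω → T → ℝ) (i : ℕ) (ω : Ω)
    (s : T) : ℝ :=
  ζ i ω * Ys i ω s

/-- The max-stable process `η(s) = max_i ζ_i Y_i(s)`. It is defined as a supremum in the extended
reals, so that it means the right thing for every outcome. -/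
def maxStable {Ω T : Type*} (ζ : ℕ → Ω → ℝ) (Ys : ℕ → Ω → T → ℝ) (ω : Ω) (s : T) : EReal :=
  ⨆ i, (spectralFunction ζ Ys i ω s : EReal)

/-- The extremal concurrence probability: the probability that one single function `φ_ℓ` attains
the maximum `η` at all the points `s_1, …, s_k`. -/
def extremalConcurrenceProb {Ω T : Type*} [MeasurableSpace Ω] (ζ : ℕ → Ω → ℝ)
    (Ys : ℕ → Ω → T → ℝ) (P : Measure Ω) {k : ℕ} (s : Fin k → T) : ℝ≥0∞ :=
  P {ω | ∃ l : ℕ, ∀ j, maxStable ζ Ys ω (s j) = (spectralFunction ζ Ys l ω (s j) : EReal)}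

end Concurrence

end

/-!
Let `R u v = max_j u j / v j` and `c v = E R(Y, v)`. The function `ζ v` dominates all the others iff
`ζ` is at least the largest of the numbers `ζ i * R (Y i) v` coming from the other points. By the
Mecke formula, the expected number of pairs of a point `ζ` and a value of that maximum is governed
by the product of `z⁻² dz` and the law of the maximum over all points, which is the Fréchet law
with distribution function `t ↦ exp (- c v / t)`. So the expected number of dominating points is
`E ∫ exp (- c(Y) / z) z⁻² dz = E (c(Y)⁻¹)`. Two points dominate at once only if there is a tie,
which has probability zero because `z⁻² dz` has no atoms; the expected number of dominating points
is therefore the probability that there is one.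
-/

namespace Concurrence

/-- The function `x ↦ exp (-x)` on `[0, ∞]`, with `exp (-∞) = 0`. It turns infinite sums into
infinite products. -/
noncomputable def expNeg (x : ℝ≥0∞) : ℝ≥0∞ := EReal.exp (-(x : EReal))

lemma expNeg_zero : expNeg 0 = 1 := by simp [expNeg]

lemma expNeg_top : expNeg ∞ = 0 := by simp [expNeg]

lemma expNeg_ofReal {x : ℝ} (hx : 0 ≤ x) :
    expNeg (ENNReal.ofReal x) = ENNReal.ofReal (Real.exp (-x)) := by
  rw [expNeg, EReal.coe_ennreal_ofReal, max_eq_left hx, ← EReal.coe_neg, EReal.exp_coe]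

lemma expNeg_antitone : Antitone expNeg := fun x y h => by
  simpa [expNeg, EReal.exp_le_exp_iff] using h

lemma expNeg_le_one (x : ℝ≥0∞) : expNeg x ≤ 1 :=
  expNeg_zero ▸ expNeg_antitone zero_le

lemma expNeg_lt_one {x : ℝ≥0∞} (hx : x ≠ 0) : expNeg x < 1 := by
  rw [expNeg, EReal.exp_lt_one_iff, EReal.neg_lt_zero]
  simpa [pos_iff_ne_zero] using hx

lemma continuous_expNeg : Continuous expNeg :=
  ENNReal.continuous_exp.comp (continuous_neg.comp continuous_coe_ennreal_ereal)

@[fun_prop]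
lemma measurable_expNeg : Measurable expNeg := continuous_expNeg.measurable

lemma expNeg_add (x y : ℝ≥0∞) : expNeg (x + y) = expNeg x * expNeg y := by
  rw [expNeg, EReal.coe_ennreal_add, EReal.neg_add (by simp) (by simp), sub_eq_add_neg,
    EReal.exp_add, expNeg, expNeg]

lemma expNeg_sum {ι : Type*} (s : Finset ι) (f : ι → ℝ≥0∞) :
    expNeg (∑ i ∈ s, f i) = ∏ i ∈ s, expNeg (f i) := by
  induction s using Finset.cons_induction with
  | empty => simp [expNeg_zero]
  | cons i s hi ih => rw [Finset.sum_cons, Finset.prod_cons, expNeg_add, ih]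

lemma expNeg_tsum {ι : Type*} (f : ι → ℝ≥0∞) :
    expNeg (∑' i, f i) = ∏' i, expNeg (f i) := by
  have h : HasProd (fun i => expNeg (f i)) (expNeg (∑' i, f i)) := by
    have := (continuous_expNeg.tendsto _).comp (ENNReal.summable (f := f)).hasSum
    simpa only [HasProd, Function.comp_def, expNeg_sum] using this
  exact h.tprod_eq.symm

lemma expNeg_natCast_mul (n : ℕ) (x : ℝ≥0∞) : expNeg (n * x) = expNeg x ^ n := by
  simpa using expNeg_sum (Finset.range n) (fun _ => x)

/-- The inverse of `expNeg` on `[0, 1]`. -/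
noncomputable def negLog (x : ℝ≥0∞) : ℝ≥0∞ := (-ENNReal.log x).toENNReal

lemma expNeg_negLog {x : ℝ≥0∞} (hx : x ≤ 1) : expNeg (negLog x) = x := by
  rw [expNeg, negLog, EReal.coe_toENNReal, neg_neg, ENNReal.exp_log]
  simpa [EReal.neg_nonneg] using hx

@[fun_prop]
lemma measurable_negLog : Measurable negLog :=
  measurable_ereal_toENNReal.comp (continuous_neg.measurable.comp ENNReal.measurable_log)

lemma lintegral_expNeg_mul (c : ℝ≥0∞) :
    ∫⁻ x in Set.Ioi 0, expNeg (c * ENNReal.ofReal x) = c⁻¹ := by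
  rcases eq_or_ne c ∞ with rfl | hc
  · rw [setLIntegral_congr_fun (g := 0) measurableSet_Ioi fun x hx => by
      simp [ENNReal.top_mul (ENNReal.ofReal_pos.2 hx).ne', expNeg_top]]
    simp
  rcases eq_or_ne c 0 with rfl | hc0
  · simp [expNeg_zero]
  lift c to NNReal using hc
  have hc' : 0 < (c : ℝ) := by simpa [pos_iff_ne_zero] using hc0
  have hint : IntegrableOn (fun x => Real.exp (-(c : ℝ) * x)) (Set.Ioi 0) :=
    integrableOn_exp_mul_Ioi (neg_lt_zero.2 hc') 0
  calc ∫⁻ x in Set.Ioi 0, expNeg (c * ENNReal.ofReal x)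
      = ∫⁻ x in Set.Ioi 0, ENNReal.ofReal (Real.exp (-(c : ℝ) * x)) := by
        refine setLIntegral_congr_fun measurableSet_Ioi fun x hx => ?_
        have hx : 0 < x := hx
        rw [← ENNReal.ofReal_coe_nnreal, ← ENNReal.ofReal_mul hc'.le, expNeg_ofReal (by positivity),
          neg_mul]
    _ = ENNReal.ofReal (∫ x in Set.Ioi 0, Real.exp (-(c : ℝ) * x)) :=
        (ofReal_integral_eq_lintegral_ofReal hint (ae_of_all _ fun x => by positivity)).symm
    _ = (c : ℝ≥0∞)⁻¹ := by
        rw [integral_exp_mul_Ioi (neg_lt_zero.2 hc') 0, mul_zero, Real.exp_zero, neg_div_neg_eq,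
          one_div, ENNReal.ofReal_inv_of_pos hc', ENNReal.ofReal_coe_nnreal]

lemma inverseSquareMeasure_eq_map_inv :
    inverseSquareMeasure = (volume.restrict (Set.Ioi 0)).map Inv.inv := by
  ext A hA
  have hd : ∀ x ∈ Set.Ioi (0 : ℝ), HasDerivWithinAt Inv.inv (-(x ^ 2)⁻¹) (Set.Ioi 0) x :=
    fun x hx => (hasDerivAt_inv (ne_of_gt hx)).hasDerivWithinAt
  have hinv : ((volume.restrict (Set.Ioi (0 : ℝ))).map Inv.inv) A =
      ∫⁻ x in Inv.inv '' Set.Ioi 0, (Inv.inv ⁻¹' A).indicator 1 x := by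
    have hIoi : (Set.Ioi (0 : ℝ))⁻¹ = Set.Ioi 0 := by ext; simp
    rw [Set.image_inv_eq_inv, hIoi, lintegral_indicator_one (measurable_inv hA),
      Measure.map_apply measurable_inv hA]
  rw [hinv, lintegral_image_eq_lintegral_abs_deriv_mul measurableSet_Ioi hd
    inv_injective.injOn, inverseSquareMeasure, withDensity_apply _ hA, ← lintegral_indicator hA]
  refine lintegral_congr fun x => ?_
  by_cases hx : x ∈ A <;> simp [hx, Set.indicator]

lemma lintegral_expNeg_div_ofReal (c : ℝ≥0∞) :
    ∫⁻ z, expNeg (c / ENNReal.ofReal z) ∂inverseSquareMeasure = c⁻¹ := by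
  rw [inverseSquareMeasure_eq_map_inv, lintegral_map (by fun_prop) measurable_inv,
    ← lintegral_expNeg_mul]
  refine setLIntegral_congr_fun measurableSet_Ioi fun x hx => ?_
  simp only [ENNReal.ofReal_inv_of_pos (Set.mem_Ioi.1 hx), div_eq_mul_inv, inv_inv]

lemma volume_Ioi_inter_setOf_ofReal_lt (x : ℝ≥0∞) :
    volume (Set.Ioi 0 ∩ {y | ENNReal.ofReal y < x}) = x := by
  rcases eq_or_ne x ∞ with rfl | hx
  · simp
  have hset : Set.Ioi 0 ∩ {y | ENNReal.ofReal y < x} = Set.Ioo 0 x.toReal := by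
    ext y
    exact and_congr_right fun hy => ENNReal.ofReal_lt_iff_lt_toReal hy.le hx
  rw [hset, Real.volume_Ioo, sub_zero, ENNReal.ofReal_toReal hx]

lemma inverseSquareMeasure_setOf_lt_mul (t r : ℝ≥0∞) :
    inverseSquareMeasure {z | t < ENNReal.ofReal z * r} = r / t := by
  have hset : Set.Ioi 0 ∩ Inv.inv ⁻¹' {z : ℝ | t < ENNReal.ofReal z * r} =
      Set.Ioi 0 ∩ {y | ENNReal.ofReal y < r / t} := by
    ext y
    refine and_congr_right fun hy => ?_
    have hy0 : ENNReal.ofReal y ≠ 0 := by simpa using hy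
    rw [Set.mem_preimage, Set.mem_ofPred_eq, Set.mem_ofPred_eq,
      ENNReal.ofReal_inv_of_pos hy, mul_comm, ← div_eq_mul_inv]
    rw [ENNReal.lt_div_iff_mul_lt (.inl hy0) (.inl ENNReal.ofReal_ne_top)]
    rcases eq_or_ne t 0 with rfl | ht
    · rcases eq_or_ne r 0 with rfl | hr <;> simp [ENNReal.div_zero, pos_iff_ne_zero, *]
    rcases eq_or_ne t ∞ with rfl | ht'
    · simp [ENNReal.top_mul hy0]
    rw [ENNReal.lt_div_iff_mul_lt (.inl ht) (.inl ht'), mul_comm]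
  rw [inverseSquareMeasure_eq_map_inv, Measure.map_apply measurable_inv
    (measurableSet_lt (by fun_prop) (by fun_prop)), Measure.restrict_apply' measurableSet_Ioi,
    Set.inter_comm, hset, volume_Ioi_inter_setOf_ofReal_lt]

instance : SigmaFinite inverseSquareMeasure := by
  unfold inverseSquareMeasure
  exact SigmaFinite.withDensity_ofReal _

instance : NullSingletonClass inverseSquareMeasure :=
  ⟨fun x => withDensity_absolutelyContinuous _ _ (measure_singleton x)⟩

lemma ae_inverseSquareMeasure_pos : ∀ᵐ z ∂inverseSquareMeasure, 0 < z :=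
  (withDensity_absolutelyContinuous _ _).ae_le (ae_restrict_mem measurableSet_Ioi)

lemma tsum_poissonMeasure_mul_pow (r : NNReal) {x : ℝ≥0∞} (hx : x ≤ 1) :
    ∑' n : ℕ, poissonMeasure r {n} * x ^ n = expNeg (r * (1 - x)) := by
  lift x to NNReal using ne_top_of_le_ne_top ENNReal.one_ne_top hx
  have hx1 : (x : ℝ) ≤ 1 := by exact_mod_cast hx
  have hr : (r * (1 - x) : ℝ≥0∞) = ENNReal.ofReal (r * (1 - x)) := by
    rw [ENNReal.ofReal_mul r.coe_nonneg, ENNReal.ofReal_sub _ x.coe_nonneg]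
    simp
  have hs : HasSum (fun n : ℕ => Real.exp (-r) * ((r * x : ℝ) ^ n / n.factorial))
      (Real.exp (-(r * (1 - x)))) := by
    have := (NormedSpace.expSeries_div_hasSum_exp (r * x : ℝ)).mul_left (Real.exp (-r))
    rwa [← Real.exp_eq_exp_ℝ, ← Real.exp_add, neg_add_eq_sub, ← neg_sub, ← mul_one_sub] at this
  rw [hr, expNeg_ofReal (mul_nonneg r.coe_nonneg (sub_nonneg.2 hx1)), ← hs.tsum_eq,
    ENNReal.ofReal_tsum_of_nonneg (fun n => by positivity) hs.summable]
  refine tsum_congr fun n => ?_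
  rw [poissonMeasure_singleton, ← ENNReal.ofReal_coe_nnreal (p := x),
    ← ENNReal.ofReal_pow x.coe_nonneg, ← ENNReal.ofReal_mul (by positivity)]
  congr 1
  ring

lemma tsum_poissonMeasure_mul_mul_pow (r : NNReal) {x : ℝ≥0∞} (hx : x ≤ 1) :
    ∑' n : ℕ, poissonMeasure r {n} * (n * x ^ (n - 1)) = r * expNeg (r * (1 - x)) := by
  have hsucc : ∀ n : ℕ, poissonMeasure r {n + 1} * (n + 1 : ℕ) = r * poissonMeasure r {n} := by
    intro n
    rw [poissonMeasure_singleton, poissonMeasure_singleton, ← ENNReal.ofReal_natCast,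
      ← ENNReal.ofReal_coe_nnreal (p := r), ← ENNReal.ofReal_mul (by positivity),
      ← ENNReal.ofReal_mul (by positivity), Nat.factorial_succ]
    congr 1
    push_cast
    field_simp
    ring
  rw [tsum_eq_zero_add' ENNReal.summable, ← tsum_poissonMeasure_mul_pow r hx,
    ← ENNReal.tsum_mul_left]
  simp only [Nat.cast_zero, zero_mul, mul_zero, zero_add, Nat.add_sub_cancel, ← mul_assoc, hsucc]

section PointCount

variable {Ω E : Type*} {ζ : ℕ → Ω → E} {A : Set E}

lemma tsum_indicator_const_eq_pointCount_mul (ζ : ℕ → Ω → E) (A : Set E) (c : ℝ≥0∞) (ω : Ω) :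
    ∑' i, A.indicator (fun _ => c) (ζ i ω) = pointCount ζ A ω * c := by
  rw [pointCount, ← ENNReal.tsum_set_const, tsum_subtype {i : ℕ | ζ i ω ∈ A} (fun _ => c)]
  rfl

lemma tsum_compl_singleton_indicator_const (c : ℝ≥0∞) {l : ℕ} {ω : Ω} (hl : ζ l ω ∈ A) :
    ∑' i : ({l}ᶜ : Set ℕ), A.indicator (fun _ => c) (ζ i ω) =
      (pointCount ζ A ω - 1 : ℕ∞) * c := by
  rw [pointCount, ← Set.encard_sdiff_singleton_of_mem (a := l) (by exact hl),
    ← ENNReal.tsum_set_const, tsum_subtype ({l}ᶜ : Set ℕ) fun i => A.indicator (fun _ => c) (ζ i ω),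
    tsum_subtype ({i : ℕ | ζ i ω ∈ A} \ {l}) (fun _ => c)]
  refine tsum_congr fun i => ?_
  by_cases hil : i = l <;> by_cases hi : ζ i ω ∈ A <;> simp [hil, hi]

variable [MeasurableSpace Ω] [MeasurableSpace E]

lemma measurable_pointCount (hζ : ∀ i, Measurable (ζ i)) (hA : MeasurableSet A) :
    Measurable (pointCount ζ A) :=
  measurable_encard.comp
    (measurable_set_iff.2 fun i => (measurable_mem.2 hA).comp (hζ i))

end PointCount

namespace IsPoissonProcess

variable {Ω E : Type*} [MeasurableSpace Ω] [MeasurableSpace E] {ζ : ℕ → Ω → E} {μ : Measure E}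
  {P : Measure Ω} {A B : Set E}

lemma iIndepFun_pointCount (h : IsPoissonProcess ζ μ P) {ι : Type*} [Finite ι] {A : ι → Set E}
    (hA : ∀ i, MeasurableSet (A i)) (hd : Pairwise (Function.onFun Disjoint A)) :
    iIndepFun (fun i => pointCount ζ (A i)) P := by
  obtain ⟨n, ⟨e⟩⟩ := Finite.exists_equiv_fin ι
  have hfin := h.indep n (fun i => A (e.symm i)) (fun i => hA _)
    (fun i j hij => hd (e.symm.injective.ne hij))
  simpa using hfin.precomp e.injective

-- Independence of the empty family forces the total mass to be one.
lemma isProbabilityMeasure (h : IsPoissonProcess ζ μ P) : IsProbabilityMeasure P :=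
  (h.iIndepFun_pointCount (A := fun i : Empty => i.elim) (fun i => i.elim)
    (fun i => i.elim)).isProbabilityMeasure

lemma map_pointCount (h : IsPoissonProcess ζ μ P) (hA : MeasurableSet A) (hfin : μ A ≠ ∞) :
    P.map (pointCount ζ A) = (poissonMeasure (μ A).toNNReal).map (Nat.cast : ℕ → ℕ∞) := by
  have hN := measurable_pointCount h.measurable hA
  have hc : Measurable (Nat.cast : ℕ → ℕ∞) := .of_discrete
  have := h.isProbabilityMeasure
  have := Measure.isProbabilityMeasure_map (μ := P) hN.aemeasurable
  have := Measure.isProbabilityMeasure_map (μ := poissonMeasure (μ A).toNNReal) hc.aemeasurable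
  have hnat : ∀ n : ℕ, P.map (pointCount ζ A) {(n : ℕ∞)} =
      (poissonMeasure (μ A).toNNReal).map (Nat.cast : ℕ → ℕ∞) {(n : ℕ∞)} := by
    intro n
    have hpre : (Nat.cast : ℕ → ℕ∞) ⁻¹' {(n : ℕ∞)} = {n} := by ext; simp
    rw [Measure.map_apply hN (measurableSet_singleton _),
      Measure.map_apply hc (measurableSet_singleton _), hpre]
    exact h.poisson A hA hfin n
  have htop : ({⊤} : Set ℕ∞) = (⋃ n : ℕ, {(n : ℕ∞)})ᶜ := by
    ext x
    induction x using ENat.recTopCoe <;> simp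
  have hdisj : Pairwise (Function.onFun Disjoint fun n : ℕ => ({(n : ℕ∞)} : Set ℕ∞)) :=
    fun m n hmn => by simpa [Function.onFun] using hmn
  refine Measure.ext_of_singleton fun x => ?_
  induction x using ENat.recTopCoe with
  | coe n => exact hnat n
  | top =>
    simp_rw [htop, prob_compl_eq_one_sub (MeasurableSet.of_discrete),
      measure_iUnion hdisj (fun _ => measurableSet_singleton _), hnat]

lemma lintegral_pointCount (h : IsPoissonProcess ζ μ P) (hA : MeasurableSet A)
    (hfin : μ A ≠ ∞) (Φ : ℕ∞ → ℝ≥0∞) :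
    ∫⁻ ω, Φ (pointCount ζ A ω) ∂P = ∑' n : ℕ, poissonMeasure (μ A).toNNReal {n} * Φ n := by
  rw [← lintegral_map (Measurable.of_discrete (f := Φ)) (measurable_pointCount h.measurable hA),
    h.map_pointCount hA hfin, lintegral_map .of_discrete .of_discrete, lintegral_countable']
  exact tsum_congr fun n => mul_comm _ _

lemma lintegral_expNeg_pointCount_mul (h : IsPoissonProcess ζ μ P) (hA : MeasurableSet A)
    (a : ℝ≥0∞) :
    ∫⁻ ω, expNeg (pointCount ζ A ω * a) ∂P = expNeg (μ A * (1 - expNeg a)) := by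
  have := h.isProbabilityMeasure
  rcases eq_or_ne a 0 with rfl | ha
  · simp [expNeg_zero]
  by_cases hfin : μ A = ∞
  · have hae : ∀ᵐ ω ∂P, expNeg (pointCount ζ A ω * a) = 0 := by
      filter_upwards [h.infinite A hA hfin] with ω hω
      rw [hω, ENat.toENNReal_top, ENNReal.top_mul ha, expNeg_top]
    rw [lintegral_congr_ae hae, lintegral_zero, hfin,
      ENNReal.top_mul (tsub_pos_of_lt (expNeg_lt_one ha)).ne', expNeg_top]
  · rw [h.lintegral_pointCount hA hfin fun n => expNeg (n * a)]
    simp_rw [ENat.toENNReal_coe, expNeg_natCast_mul]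
    rw [tsum_poissonMeasure_mul_pow _ (expNeg_le_one a), ENNReal.coe_toNNReal hfin]

lemma lintegral_pointCount_mul_expNeg (h : IsPoissonProcess ζ μ P) (hA : MeasurableSet A)
    (hfin : μ A ≠ ∞) (a : ℝ≥0∞) :
    ∫⁻ ω, pointCount ζ A ω * expNeg ((pointCount ζ A ω - 1 : ℕ∞) * a) ∂P =
      μ A * expNeg (μ A * (1 - expNeg a)) := by
  have hpred : ∀ n : ℕ, (((n : ℕ∞) - 1 : ℕ∞) : ℝ≥0∞) = ((n - 1 : ℕ) : ℝ≥0∞) := fun n => by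
    rw [← ENat.toENNReal_coe, ENat.natCast_sub, Nat.cast_one]
  rw [h.lintegral_pointCount hA hfin fun n => n * expNeg ((n - 1 : ℕ∞) * a)]
  simp_rw [ENat.toENNReal_coe, hpred, expNeg_natCast_mul]
  rw [tsum_poissonMeasure_mul_mul_pow _ (expNeg_le_one a), ENNReal.coe_toNNReal hfin]

end IsPoissonProcess

section ReducedCampbell

variable {Ω E : Type*} [MeasurableSpace Ω] [MeasurableSpace E] {ζ : ℕ → Ω → E} {P : Measure Ω}
  {f : E → ℝ≥0∞} {B : Set E}

/-- The reduced Campbell measure `B ↦ E ∑ l, 1_B (ζ l) exp (-∑ i ≠ l, f (ζ i))` of the random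
points `ζ`, in which every point is weighted by a functional of the other points. The sum over the
points is an integral against the counting measure. -/
noncomputable def reducedCampbell (ζ : ℕ → Ω → E) (f : E → ℝ≥0∞) (P : Measure Ω) : Measure E :=
  ((Measure.count.prod P).withDensity fun p => expNeg (∑' i : ({p.1}ᶜ : Set ℕ), f (ζ i p.2))).map
    fun p => ζ p.1 p.2

lemma measurable_expNeg_tsum_compl (hζ : ∀ i, Measurable (ζ i)) (hf : Measurable f) :
    Measurable fun p : ℕ × Ω => expNeg (∑' i : ({p.1}ᶜ : Set ℕ), f (ζ i p.2)) := by
  have htail : ∀ l : ℕ, Measurable fun ω => ∑' i : ({l}ᶜ : Set ℕ), f (ζ i ω) := fun l =>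
    Measurable.tsum fun i => hf.comp (hζ i)
  exact measurable_from_prod_countable_right fun l => measurable_expNeg.comp (htail l)

lemma reducedCampbell_apply (hζ : ∀ i, Measurable (ζ i)) (hB : MeasurableSet B) :
    reducedCampbell ζ f P B = ∫⁻ p in (fun p : ℕ × Ω => ζ p.1 p.2) ⁻¹' B,
      expNeg (∑' i : ({p.1}ᶜ : Set ℕ), f (ζ i p.2)) ∂(Measure.count.prod P) := by
  have hm : Measurable fun p : ℕ × Ω => ζ p.1 p.2 := measurable_from_prod_countable_right hζ
  rw [reducedCampbell, Measure.map_apply hm hB, withDensity_apply _ (hm hB)]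

lemma reducedCampbell_apply_eq_tsum [SFinite P] (hζ : ∀ i, Measurable (ζ i)) (hf : Measurable f)
    (hB : MeasurableSet B) :
    reducedCampbell ζ f P B =
      ∑' l, ∫⁻ ω in ζ l ⁻¹' B, expNeg (∑' i : ({l}ᶜ : Set ℕ), f (ζ i ω)) ∂P := by
  have hm : Measurable fun p : ℕ × Ω => ζ p.1 p.2 := measurable_from_prod_countable_right hζ
  rw [reducedCampbell_apply hζ hB, ← lintegral_indicator (hm hB),
    lintegral_prod _ ((measurable_expNeg_tsum_compl hζ hf).indicator (hm hB)).aemeasurable,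
    lintegral_count]
  refine tsum_congr fun l => ?_
  rw [← lintegral_indicator (hζ l hB)]
  rfl

lemma tendsto_reducedCampbell (hζ : ∀ i, Measurable (ζ i)) {F : ℕ → E → ℝ≥0∞}
    (hF : ∀ n, Measurable (F n)) (hmono : ∀ x, Monotone fun n => F n x)
    (hlim : ∀ x, Filter.Tendsto (fun n => F n x) Filter.atTop (nhds (f x)))
    (hB : MeasurableSet B) (hfin : reducedCampbell ζ 0 P B ≠ ∞) :
    Filter.Tendsto (fun n => reducedCampbell ζ (F n) P B) Filter.atTop
      (nhds (reducedCampbell ζ f P B)) := by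
  simp only [reducedCampbell_apply hζ hB] at hfin ⊢
  refine tendsto_lintegral_of_dominated_convergence 1
    (fun n => measurable_expNeg_tsum_compl hζ (hF n))
    (fun n => ae_of_all _ fun p => expNeg_le_one _) (by simpa [expNeg_zero] using hfin)
    (ae_of_all _ fun p => (continuous_expNeg.tendsto _).comp ?_)
  simp_rw [← lintegral_count]
  exact lintegral_tendsto_of_tendsto_of_monotone (fun n => Measurable.of_discrete.aemeasurable)
    (ae_of_all _ fun i => hmono _) (ae_of_all _ fun i => hlim _)

end ReducedCampbell

lemma indicator_comp_simpleFunc_eq_sum {E α β : Type*} [MeasurableSpace E] [AddCommMonoid β]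
    (f : SimpleFunc E α) (A : Set E) (F : α → β) (x : E) :
    A.indicator (fun x => F (f x)) x =
      ∑ a : f.range, (A ∩ f ⁻¹' {(a : α)}).indicator (fun _ => F a) x := by
  rw [Finset.sum_eq_single (⟨f x, f.mem_range_self x⟩ : f.range)]
  · by_cases hx : x ∈ A <;> simp [hx]
  · exact fun a _ ha => Set.indicator_of_notMem (fun h => ha (Subtype.ext h.2.symm)) _
  · simp

lemma tsum_indicator_expNeg_tsum_compl {Ω E : Type*} {ζ : ℕ → Ω → E} {f : E → ℝ≥0∞} {B : Set E}
    {a : ℝ≥0∞} (hfB : ∀ x ∈ B, f x = a) (ω : Ω) :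
    ∑' l, B.indicator (fun _ => expNeg (∑' i : ({l}ᶜ : Set ℕ), f (ζ i ω))) (ζ l ω) =
      pointCount ζ B ω * expNeg ((pointCount ζ B ω - 1 : ℕ∞) * a) *
        expNeg (∑' i, Bᶜ.indicator f (ζ i ω)) := by
  have hf : ∀ x, f x = B.indicator (fun _ => a) x + Bᶜ.indicator f x := by
    intro x
    by_cases hx : x ∈ B <;> simp [hx, hfB]
  rw [mul_assoc, ← tsum_indicator_const_eq_pointCount_mul]
  refine tsum_congr fun l => ?_
  by_cases hl : ζ l ω ∈ B
  · have htail : ∑' i : ({l}ᶜ : Set ℕ), Bᶜ.indicator f (ζ i ω) =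
        ∑' i, Bᶜ.indicator f (ζ i ω) := by
      rw [tsum_subtype ({l}ᶜ : Set ℕ) fun i => Bᶜ.indicator f (ζ i ω)]
      refine tsum_congr fun i => ?_
      by_cases hil : i = l <;> simp [hil, hl]
    simp_rw [Set.indicator_of_mem hl, fun i : ({l}ᶜ : Set ℕ) => hf (ζ i ω)]
    rw [ENNReal.tsum_add, tsum_compl_singleton_indicator_const a hl, htail, expNeg_add]
  · simp_rw [Set.indicator_of_notMem hl]

namespace IsPoissonProcess

variable {Ω E : Type*} [MeasurableSpace Ω] [MeasurableSpace E] {ζ : ℕ → Ω → E} {μ : Measure E}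
  {P : Measure Ω} {B : Set E}

lemma lintegral_prod_pointCount (h : IsPoissonProcess ζ μ P) {ι : Type*} [Fintype ι]
    {A : ι → Set E} (hA : ∀ i, MeasurableSet (A i)) (hd : Pairwise (Function.onFun Disjoint A))
    (Φ : ι → ℕ∞ → ℝ≥0∞) :
    ∫⁻ ω, ∏ i, Φ i (pointCount ζ (A i) ω) ∂P = ∏ i, ∫⁻ ω, Φ i (pointCount ζ (A i) ω) ∂P :=
  lintegral_prod_eq_prod_lintegral_of_indepFun Finset.univ
    (fun i ω => Φ i (pointCount ζ (A i) ω))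
    ((h.iIndepFun_pointCount hA hd).comp Φ fun _ => .of_discrete)
    fun i => (Measurable.of_discrete (f := Φ i)).comp (measurable_pointCount h.measurable (hA i))

lemma lintegral_mul_expNeg_tsum_simpleFunc (h : IsPoissonProcess ζ μ P) (hB : MeasurableSet B)
    (Φ : ℕ∞ → ℝ≥0∞) (f : SimpleFunc E ℝ≥0∞) :
    ∫⁻ ω, Φ (pointCount ζ B ω) * expNeg (∑' i, Bᶜ.indicator f (ζ i ω)) ∂P =
      (∫⁻ ω, Φ (pointCount ζ B ω) ∂P) * expNeg (∫⁻ x in Bᶜ, (1 - expNeg (f x)) ∂μ) := by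
  let A : Option f.range → Set E := fun o => o.elim B fun a => Bᶜ ∩ f ⁻¹' {(a : ℝ≥0∞)}
  have hA : ∀ o, MeasurableSet (A o) := by
    rintro (_ | a)
    · exact hB
    · exact hB.compl.inter (f.measurableSet_fiber _)
  have hd : Pairwise (Function.onFun Disjoint A) := by
    rintro (_ | a) (_ | b) hab
    · exact absurd rfl hab
    · exact Set.disjoint_left.2 fun x hx hx' => hx'.1 hx
    · exact Set.disjoint_left.2 fun x hx hx' => hx.1 hx'
    · refine Set.disjoint_left.2 fun x hx hx' => hab ?_
      rw [Subtype.ext (hx.2.symm.trans hx'.2)]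
  have hsum : ∀ ω, ∑' i, Bᶜ.indicator f (ζ i ω) =
      ∑ a : f.range, pointCount ζ (A (some a)) ω * (a : ℝ≥0∞) := by
    intro ω
    simp_rw [← tsum_indicator_const_eq_pointCount_mul]
    rw [← Summable.tsum_finsetSum fun _ _ => ENNReal.summable]
    exact tsum_congr fun i => indicator_comp_simpleFunc_eq_sum f Bᶜ id (ζ i ω)
  have hint : ∫⁻ x in Bᶜ, (1 - expNeg (f x)) ∂μ =
      ∑ a : f.range, μ (A (some a)) * (1 - expNeg a) := by
    rw [← lintegral_indicator hB.compl]
    simp_rw [indicator_comp_simpleFunc_eq_sum f Bᶜ (fun a => 1 - expNeg a)]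
    refine (lintegral_finsetSum _ fun a _ => measurable_const.indicator (hA (some a))).trans ?_
    exact Finset.sum_congr rfl fun a _ => by rw [lintegral_indicator_const (hA (some a)), mul_comm]
  have hprod := h.lintegral_prod_pointCount hA hd
    fun o n => o.elim (Φ n) fun a => expNeg (n * (a : ℝ≥0∞))
  simp only [Fintype.prod_option, Option.elim] at hprod
  simp_rw [hsum, hint, expNeg_sum, ← h.lintegral_expNeg_pointCount_mul (hA (some _))]
  exact hprod

lemma reducedCampbell_apply_of_forall_eq (h : IsPoissonProcess ζ μ P) (hB : MeasurableSet B)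
    (hfin : μ B ≠ ∞) (f : SimpleFunc E ℝ≥0∞) {a : ℝ≥0∞} (hfB : ∀ x ∈ B, f x = a) :
    reducedCampbell ζ f P B = expNeg (∫⁻ x, (1 - expNeg (f x)) ∂μ) * μ B := by
  have := h.isProbabilityMeasure
  have htail : ∀ l : ℕ, Measurable fun ω => expNeg (∑' i : ({l}ᶜ : Set ℕ), f (ζ i ω)) := fun l =>
    (measurable_expNeg_tsum_compl h.measurable f.measurable).comp measurable_prodMk_left
  calc reducedCampbell ζ f P B
      = ∫⁻ ω, ∑' l, B.indicator (fun _ => expNeg (∑' i : ({l}ᶜ : Set ℕ), f (ζ i ω))) (ζ l ω)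
          ∂P := by
        rw [reducedCampbell_apply_eq_tsum h.measurable f.measurable hB]
        simp_rw [← lintegral_indicator (h.measurable _ hB)]
        exact (lintegral_tsum fun l =>
          ((htail l).indicator (h.measurable l hB)).aemeasurable).symm
    _ = ∫⁻ ω, pointCount ζ B ω * expNeg ((pointCount ζ B ω - 1 : ℕ∞) * a) *
          expNeg (∑' i, Bᶜ.indicator f (ζ i ω)) ∂P :=
        lintegral_congr (tsum_indicator_expNeg_tsum_compl hfB)
    _ = μ B * expNeg (μ B * (1 - expNeg a)) * expNeg (∫⁻ x in Bᶜ, (1 - expNeg (f x)) ∂μ) := by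
        rw [h.lintegral_mul_expNeg_tsum_simpleFunc hB fun n => n * expNeg ((n - 1 : ℕ∞) * a),
          h.lintegral_pointCount_mul_expNeg hB hfin]
    _ = expNeg (∫⁻ x, (1 - expNeg (f x)) ∂μ) * μ B := by
        rw [← lintegral_add_compl (μ := μ) (fun x => 1 - expNeg (f x)) hB,
          setLIntegral_congr_fun hB fun x hx => by rw [hfB x hx], setLIntegral_const,
          mul_comm (1 - expNeg a), expNeg_add]
        ring

lemma reducedCampbell_simpleFunc [SigmaFinite μ] (h : IsPoissonProcess ζ μ P)
    (f : SimpleFunc E ℝ≥0∞) :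
    reducedCampbell ζ f P = expNeg (∫⁻ x, (1 - expNeg (f x)) ∂μ) • μ := by
  let B : f.range × ℕ → Set E := fun q => f ⁻¹' {(q.1 : ℝ≥0∞)} ∩ spanningSets μ q.2
  have hB : ⋃ q, B q = Set.univ := Set.eq_univ_of_forall fun x => Set.mem_iUnion.2
    ⟨(⟨f x, f.mem_range_self x⟩, spanningSetsIndex μ x), rfl, mem_spanningSetsIndex μ x⟩
  refine Measure.ext_of_iUnion_eq_univ hB fun q => Measure.ext fun A hA => ?_
  have hq : MeasurableSet (B q) :=
    (f.measurableSet_fiber _).inter (measurableSet_spanningSets μ q.2)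
  rw [Measure.restrict_apply hA, Measure.restrict_apply hA, Measure.smul_apply, smul_eq_mul]
  refine h.reducedCampbell_apply_of_forall_eq (hA.inter hq) (ne_of_lt ?_) f fun x hx => hx.2.1
  exact (measure_mono fun x hx => hx.2.2).trans_lt (measure_spanningSets_lt_top μ q.2)

theorem reducedCampbell_eq_smul [SigmaFinite μ] (h : IsPoissonProcess ζ μ P) {f : E → ℝ≥0∞}
    (hf : Measurable f) :
    reducedCampbell ζ f P = expNeg (∫⁻ x, (1 - expNeg (f x)) ∂μ) • μ := by
  refine Measure.ext_of_iUnion_eq_univ (iUnion_spanningSets μ) fun q => Measure.ext fun A hA => ?_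
  have hB : MeasurableSet (A ∩ spanningSets μ q) := hA.inter (measurableSet_spanningSets μ q)
  have hfin : μ (A ∩ spanningSets μ q) ≠ ∞ :=
    ((measure_mono Set.inter_subset_right).trans_lt (measure_spanningSets_lt_top μ q)).ne
  have hmono : ∀ x, Monotone fun n => SimpleFunc.eapprox f n x := fun x _ _ hmn =>
    SimpleFunc.monotone_eapprox f hmn x
  have hlim : Filter.Tendsto (fun n => ∫⁻ x, (1 - expNeg (SimpleFunc.eapprox f n x)) ∂μ)
      Filter.atTop (nhds (∫⁻ x, (1 - expNeg (f x)) ∂μ)) :=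
    lintegral_tendsto_of_tendsto_of_monotone (fun n => by fun_prop)
      (ae_of_all _ fun x _ _ hmn => tsub_le_tsub_left (expNeg_antitone (hmono x hmn)) 1)
      (ae_of_all _ fun x => ENNReal.Tendsto.sub tendsto_const_nhds
        ((continuous_expNeg.tendsto _).comp (SimpleFunc.tendsto_eapprox hf x))
        (.inl ENNReal.one_ne_top))
  have hzero : reducedCampbell ζ 0 P = μ := by
    simpa [expNeg_zero] using h.reducedCampbell_simpleFunc 0
  rw [Measure.restrict_apply hA, Measure.restrict_apply hA, Measure.smul_apply, smul_eq_mul]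
  refine tendsto_nhds_unique (tendsto_reducedCampbell h.measurable
    (fun n => (SimpleFunc.eapprox f n).measurable) hmono (SimpleFunc.tendsto_eapprox hf) hB
    (by rwa [hzero])) ?_
  simp_rw [h.reducedCampbell_simpleFunc, Measure.smul_apply, smul_eq_mul]
  exact ENNReal.Tendsto.mul_const ((continuous_expNeg.tendsto _).comp hlim) (.inr hfin)

lemma ae_forall [SigmaFinite μ] (h : IsPoissonProcess ζ μ P) {p : E → Prop}
    (hp : ∀ᵐ x ∂μ, p x) :
    ∀ᵐ ω ∂P, ∀ i, p (ζ i ω) := by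
  have := h.isProbabilityMeasure
  have hB := measurableSet_toMeasurable μ {x | ¬ p x}
  have hzero : reducedCampbell ζ 0 P (toMeasurable μ {x | ¬ p x}) = 0 := by
    rw [h.reducedCampbell_eq_smul measurable_zero, Measure.smul_apply, measure_toMeasurable,
      ae_iff.1 hp, smul_zero]
  rw [reducedCampbell_apply_eq_tsum h.measurable measurable_zero hB, ENNReal.tsum_eq_zero] at hzero
  refine ae_all_iff.2 fun l => ?_
  have hl : P (ζ l ⁻¹' toMeasurable μ {x | ¬ p x}) = 0 := by
    simpa [expNeg_zero] using hzero l
  exact measure_mono_null (fun ω hω => subset_toMeasurable μ {x | ¬ p x} hω) hl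

end IsPoissonProcess

lemma exists_eq_prod_of_apply_prod_Iic {E : Type*} [MeasurableSpace E] {μ : Measure E}
    [SigmaFinite μ] {C : Measure (E × ℝ≥0∞)} {G : ℝ≥0∞ → ℝ≥0∞} {A : Set E}
    (hA : MeasurableSet A) (hμA : μ A = 1) (hG : G ∞ ≠ ∞)
    (h : ∀ B, MeasurableSet B → ∀ t, C (B ×ˢ Set.Iic t) = μ B * G t) :
    ∃ ν : Measure ℝ≥0∞, IsFiniteMeasure ν ∧ (∀ t, ν (Set.Iic t) = G t) ∧ C = μ.prod ν := by
  have hν : ∀ t, (C.restrict (A ×ˢ Set.univ)).snd (Set.Iic t) = G t := fun t => by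
    rw [Measure.snd_apply measurableSet_Iic,
      Measure.restrict_apply (measurable_snd measurableSet_Iic), ← Set.univ_prod,
      Set.prod_inter_prod, Set.univ_inter, Set.inter_univ, h A hA t, hμA, one_mul]
  have hfin : IsFiniteMeasure (C.restrict (A ×ˢ Set.univ)).snd :=
    ⟨by simpa only [Set.Iic_top] using (hν ∞).trans_lt hG.lt_top⟩
  refine ⟨_, hfin, hν, (Measure.prod_eq_generateFrom MeasurableSpace.generateFrom_measurableSet
    (borel_eq_generateFrom_Iic ℝ≥0∞ ▸ BorelSpace.measurable_eq).symm
    MeasurableSpace.isPiSystem_measurableSet isPiSystem_Iic μ.toFiniteSpanningSetsIn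
    ⟨fun _ => Set.Iic ∞, fun _ => ⟨∞, rfl⟩, fun _ => measure_lt_top _ _,
      by simp [Set.iUnion_const]⟩ ?_).symm⟩
  rintro B hB _ ⟨t, rfl⟩
  rw [h B hB, hν]

section Rivals

variable {Ω V : Type*} {ζ : ℕ → Ω → ℝ} {r : V → ℝ≥0∞}

/-- The largest of the scaled marks `ζ i * r (w i)` with index `i ≠ l`, at the outcome `(ω, w)` of
the points `ζ i` and the marks `w i`. -/
noncomputable def rivalSup (ζ : ℕ → Ω → ℝ) (r : V → ℝ≥0∞) (l : ℕ) (p : Ω × (ℕ → V)) : ℝ≥0∞ :=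
  ⨆ i : ({l}ᶜ : Set ℕ), ENNReal.ofReal (ζ i p.1) * r (p.2 i)

lemma rivalSup_le_iff {l : ℕ} {p : Ω × (ℕ → V)} {t : ℝ≥0∞} :
    rivalSup ζ r l p ≤ t ↔ ∀ i ≠ l, ENNReal.ofReal (ζ i p.1) * r (p.2 i) ≤ t := by
  simp [rivalSup]

variable [MeasurableSpace V] {Q : Measure V}

lemma infinitePi_rivalSup_le [IsProbabilityMeasure Q] (hr : Measurable r) (l : ℕ) (ω : Ω)
    (t : ℝ≥0∞) :
    Measure.infinitePi (fun _ : ℕ => Q) {w | rivalSup ζ r l (ω, w) ≤ t} =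
      expNeg (∑' i : ({l}ᶜ : Set ℕ), negLog (Q {v | ENNReal.ofReal (ζ i ω) * r v ≤ t})) := by
  have hset : {w : ℕ → V | rivalSup ζ r l (ω, w) ≤ t} =
      Set.pi {l}ᶜ fun i => {v | ENNReal.ofReal (ζ i ω) * r v ≤ t} :=
    Set.ext fun w => rivalSup_le_iff
  have hm : ∀ i : ℕ, MeasurableSet {v | ENNReal.ofReal (ζ i ω) * r v ≤ t} := fun i =>
    measurableSet_le (hr.const_mul _) measurable_const
  rw [hset, Measure.infinitePi_pi_of_countable (μ := fun _ => Q) (s := {l}ᶜ) inferInstance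
    fun i _ => hm i, expNeg_tsum]
  simp_rw [expNeg_negLog prob_le_one]

lemma measurable_measure_ofReal_mul_le [SFinite Q] (hr : Measurable r) (t : ℝ≥0∞) :
    Measurable fun z : ℝ => Q {v | ENNReal.ofReal z * r v ≤ t} :=
  measurable_measure_prodMk_left (s := {p : ℝ × V | ENNReal.ofReal p.1 * r p.2 ≤ t})
    (measurableSet_le (by fun_prop) measurable_const)

lemma lintegral_one_sub_measure_ofReal_mul_le [IsProbabilityMeasure Q] (hr : Measurable r)
    (t : ℝ≥0∞) :
    ∫⁻ z, (1 - Q {v | ENNReal.ofReal z * r v ≤ t}) ∂inverseSquareMeasure =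
      (∫⁻ v, r v ∂Q) / t := by
  have hS : MeasurableSet {p : ℝ × V | t < ENNReal.ofReal p.1 * r p.2} :=
    measurableSet_lt measurable_const (by fun_prop)
  calc ∫⁻ z, (1 - Q {v | ENNReal.ofReal z * r v ≤ t}) ∂inverseSquareMeasure
      = ∫⁻ z, Q {v | t < ENNReal.ofReal z * r v} ∂inverseSquareMeasure := by
        refine lintegral_congr fun z => ?_
        rw [← prob_compl_eq_one_sub (measurableSet_le (by fun_prop) measurable_const)]
        simp only [Set.compl_ofPred, not_le]
    _ = ∫⁻ v, inverseSquareMeasure {z | t < ENNReal.ofReal z * r v} ∂Q :=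
        (Measure.prod_apply hS).symm.trans (Measure.prod_apply_symm hS)
    _ = (∫⁻ v, r v ∂Q) / t := by
        simp_rw [inverseSquareMeasure_setOf_lt_mul, ENNReal.div_eq_inv_mul]
        exact lintegral_const_mul _ hr

variable [MeasurableSpace Ω] {P : Measure Ω}

lemma measurable_rivalSup (hζ : ∀ i, Measurable (ζ i)) (hr : Measurable r) (l : ℕ) :
    Measurable (rivalSup ζ r l) :=
  .iSup fun i => ((hζ i).comp measurable_fst).ennreal_ofReal.mul
    (hr.comp ((measurable_pi_apply _).comp measurable_snd))

/-- The expected number of points `ζ l` for which the point together with the largest rival scaled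
mark `rivalSup ζ r l` lies in a given set, when the marks are independent with law `Q` and
independent of the points. The sum over the points is an integral against the counting measure. -/
noncomputable def pointRivalMeasure (ζ : ℕ → Ω → ℝ) (r : V → ℝ≥0∞) (P : Measure Ω)
    (Q : Measure V) : Measure (ℝ × ℝ≥0∞) :=
  (Measure.count.prod (P.prod (Measure.infinitePi fun _ : ℕ => Q))).map
    fun q => (ζ q.1 q.2.1, rivalSup ζ r q.1 q.2)

lemma pointRivalMeasure_apply [SFinite P] [IsProbabilityMeasure Q] (hζ : ∀ i, Measurable (ζ i))
    (hr : Measurable r) {K : Set (ℝ × ℝ≥0∞)} (hK : MeasurableSet K) :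
    pointRivalMeasure ζ r P Q K =
      ∑' l, P.prod (Measure.infinitePi fun _ : ℕ => Q) {p | (ζ l p.1, rivalSup ζ r l p) ∈ K} := by
  have hm : Measurable fun q : ℕ × Ω × (ℕ → V) => (ζ q.1 q.2.1, rivalSup ζ r q.1 q.2) :=
    measurable_from_prod_countable_right fun l =>
      ((hζ l).comp measurable_fst).prodMk (measurable_rivalSup hζ hr l)
  rw [pointRivalMeasure, Measure.map_apply hm hK, Measure.prod_apply (hm hK), lintegral_count]
  rfl

lemma pointRivalMeasure_prod_Iic [IsProbabilityMeasure Q]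
    (h : IsPoissonProcess ζ inverseSquareMeasure P) (hr : Measurable r) {B : Set ℝ}
    (hB : MeasurableSet B) (t : ℝ≥0∞) :
    pointRivalMeasure ζ r P Q (B ×ˢ Set.Iic t) =
      inverseSquareMeasure B * expNeg ((∫⁻ v, r v ∂Q) / t) := by
  have := h.isProbabilityMeasure
  let f : ℝ → ℝ≥0∞ := fun z => negLog (Q {v | ENNReal.ofReal z * r v ≤ t})
  have hf : Measurable f := measurable_negLog.comp (measurable_measure_ofReal_mul_le hr t)
  calc pointRivalMeasure ζ r P Q (B ×ˢ Set.Iic t)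
      = ∑' l, ∫⁻ ω in ζ l ⁻¹' B, expNeg (∑' i : ({l}ᶜ : Set ℕ), f (ζ i ω)) ∂P := by
        rw [pointRivalMeasure_apply h.measurable hr (hB.prod measurableSet_Iic)]
        refine tsum_congr fun l => ?_
        rw [← lintegral_indicator (h.measurable l hB)]
        refine (Measure.prod_apply (((h.measurable l).comp measurable_fst).prodMk
          (measurable_rivalSup h.measurable hr l) (hB.prod measurableSet_Iic))).trans
          (lintegral_congr fun ω => ?_)
        by_cases hω : ω ∈ ζ l ⁻¹' B
        · rw [Set.indicator_of_mem hω, ← infinitePi_rivalSup_le hr]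
          exact congrArg _ (Set.ext fun w => and_iff_right hω)
        · rw [Set.indicator_of_notMem hω]
          exact measure_mono_null (fun w hw => (hω hw.1).elim) measure_empty
    _ = reducedCampbell ζ f P B := (reducedCampbell_apply_eq_tsum h.measurable hf hB).symm
    _ = inverseSquareMeasure B * expNeg ((∫⁻ v, r v ∂Q) / t) := by
        rw [h.reducedCampbell_eq_smul hf, Measure.smul_apply, smul_eq_mul, mul_comm]
        simp_rw [f, expNeg_negLog prob_le_one, lintegral_one_sub_measure_ofReal_mul_le hr]

-- The second factor is the law of the largest scaled mark, a Fréchet law.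
theorem exists_pointRivalMeasure_eq_prod [IsProbabilityMeasure Q]
    (h : IsPoissonProcess ζ inverseSquareMeasure P) (hr : Measurable r) :
    ∃ ν : Measure ℝ≥0∞, IsFiniteMeasure ν ∧
      (∀ t, ν (Set.Iic t) = expNeg ((∫⁻ v, r v ∂Q) / t)) ∧
      pointRivalMeasure ζ r P Q = inverseSquareMeasure.prod ν := by
  refine exists_eq_prod_of_apply_prod_Iic (A := {z | 1 < ENNReal.ofReal z * 1})
    (measurableSet_lt measurable_const (by fun_prop))
    (by rw [inverseSquareMeasure_setOf_lt_mul, div_one]) ?_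
    fun B hB => pointRivalMeasure_prod_Iic h hr hB
  exact ((expNeg_le_one _).trans_lt ENNReal.one_lt_top).ne

lemma pointRivalMeasure_setOf_le [IsProbabilityMeasure Q]
    (h : IsPoissonProcess ζ inverseSquareMeasure P) (hr : Measurable r) :
    pointRivalMeasure ζ r P Q {q | q.2 ≤ ENNReal.ofReal q.1} = (∫⁻ v, r v ∂Q)⁻¹ := by
  obtain ⟨ν, _, hν, hprod⟩ := exists_pointRivalMeasure_eq_prod (Q := Q) h hr
  rw [hprod, Measure.prod_apply (measurableSet_le measurable_snd (by fun_prop)),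
    ← lintegral_expNeg_div_ofReal]
  exact lintegral_congr fun z => hν (ENNReal.ofReal z)

lemma pointRivalMeasure_setOf_eq [IsProbabilityMeasure Q]
    (h : IsPoissonProcess ζ inverseSquareMeasure P) (hr : Measurable r) :
    pointRivalMeasure ζ r P Q {q | q.2 = ENNReal.ofReal q.1} = 0 := by
  obtain ⟨ν, _, -, hprod⟩ := exists_pointRivalMeasure_eq_prod (Q := Q) h hr
  rw [hprod, Measure.prod_apply_symm (measurableSet_eq_fun measurable_snd (by fun_prop)),
    lintegral_eq_zero_of_ae_eq_zero]
  refine ae_of_all _ fun t => measure_mono_null_ae (t := {t.toReal}) ?_ (measure_singleton _)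
  filter_upwards [ae_inverseSquareMeasure_pos] with z hz (ht : t = _)
  exact Set.mem_singleton_iff.2 (by simp [ht, hz.le])

end Rivals

section Resampling

variable {ι : Type*} [DecidableEq ι] {X : ι → Type*} [∀ i, MeasurableSpace (X i)]
  (μ : (i : ι) → Measure (X i)) [∀ i, IsProbabilityMeasure (μ i)]

lemma map_update_infinitePi_prod (l : ι) :
    ((Measure.infinitePi μ).prod (μ l)).map (fun p => Function.update p.1 l p.2) =
      Measure.infinitePi μ := by
  refine Measure.eq_infinitePi _ fun s t ht => ?_
  have hset : (fun p : ((i : ι) → X i) × X l => Function.update p.1 l p.2) ⁻¹' Set.pi s t =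
      Set.pi (s.erase l) t ×ˢ {v | l ∈ s → v ∈ t l} := by
    ext p
    simp only [Set.mem_preimage, Set.update_mem_pi_iff, Set.mem_prod, Finset.coe_erase,
      Set.mem_ofPred_eq, Finset.mem_coe]
  rw [Measure.map_apply measurable_update' (.pi s.countable_toSet fun i _ => ht i), hset,
    Measure.prod_prod, Measure.infinitePi_pi _ fun i _ => ht i]
  by_cases hl : l ∈ s
  · simp [hl, Finset.prod_erase_mul s (fun i => μ i (t i)) hl]
  · simp [hl]

lemma prod_infinitePi_apply_update {Ω : Type*} [MeasurableSpace Ω] (P : Measure Ω) [SFinite P]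
    (l : ι) {A : Set (Ω × ((i : ι) → X i))} (hA : MeasurableSet A) :
    P.prod (Measure.infinitePi μ) A =
      ∫⁻ v, P.prod (Measure.infinitePi μ) {p | (p.1, Function.update p.2 l v) ∈ A} ∂μ l := by
  have hm : Measurable fun q : (Ω × X l) × ((i : ι) → X i) =>
      (q.1.1, Function.update q.2 l q.1.2) :=
    (measurable_fst.comp measurable_fst).prodMk
      (measurable_update'.comp (measurable_snd.prodMk (measurable_snd.comp measurable_fst)))
  have hmeas : Measurable fun q : Ω × X l =>
      Measure.infinitePi μ {w | (q.1, Function.update w l q.2) ∈ A} :=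
    measurable_measure_prodMk_left (hm hA)
  calc P.prod (Measure.infinitePi μ) A
      = ∫⁻ ω, ∫⁻ v, Measure.infinitePi μ {w | (ω, Function.update w l v) ∈ A} ∂μ l ∂P := by
        rw [Measure.prod_apply hA]
        refine lintegral_congr fun ω => ?_
        have hAω : MeasurableSet (Prod.mk ω ⁻¹' A) := measurable_prodMk_left hA
        rw [← map_update_infinitePi_prod μ l, Measure.map_apply measurable_update' hAω,
          Measure.prod_apply_symm (measurable_update' hAω), map_update_infinitePi_prod]
        rfl
    _ = ∫⁻ v, ∫⁻ ω, Measure.infinitePi μ {w | (ω, Function.update w l v) ∈ A} ∂P ∂μ l :=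
        lintegral_lintegral_swap hmeas.aemeasurable
    _ = ∫⁻ v, P.prod (Measure.infinitePi μ) {p | (p.1, Function.update p.2 l v) ∈ A} ∂μ l := by
        refine lintegral_congr fun v => ?_
        have hv : Measurable fun p : Ω × ((i : ι) → X i) => (p.1, Function.update p.2 l v) :=
          hm.comp ((measurable_fst.prodMk measurable_const).prodMk measurable_snd)
        exact (Measure.prod_apply (hv hA)).symm

end Resampling

section Dominating

variable {Ω V : Type*} {ζ : ℕ → Ω → ℝ} {R : V → V → ℝ≥0∞}

lemma rivalSup_update (r : V → ℝ≥0∞) (l : ℕ) (ω : Ω) (w : ℕ → V) (v : V) :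
    rivalSup ζ r l (ω, Function.update w l v) = rivalSup ζ r l (ω, w) :=
  iSup_congr fun i => by simp [Function.update_of_ne i.2]

/-- The outcomes `(ω, w)` of the points `ζ i` and the marks `w i` at which the point with index `l`
dominates all others, where a point `a` with mark `u` is dominated by a point `b` with mark `v` if
`a * R u v ≤ b`. -/
def dominating (ζ : ℕ → Ω → ℝ) (R : V → V → ℝ≥0∞) (l : ℕ) : Set (Ω × (ℕ → V)) :=
  {p | rivalSup ζ (fun u => R u (p.2 l)) l p ≤ ENNReal.ofReal (ζ l p.1)}

variable [MeasurableSpace Ω] [MeasurableSpace V] {P : Measure Ω} {Q : Measure V}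

lemma measurable_rivalSup_mark (hζ : ∀ i, Measurable (ζ i))
    (hR : Measurable (Function.uncurry R)) (l : ℕ) :
    Measurable fun q : V × Ω × (ℕ → V) => rivalSup ζ (fun u => R u q.1) l q.2 := by
  refine .iSup fun i => ?_
  have hpair : Measurable fun q : V × Ω × (ℕ → V) => (q.2.2 i, q.1) :=
    ((measurable_pi_apply _).comp (measurable_snd.comp measurable_snd)).prodMk measurable_fst
  exact ((hζ i).comp (measurable_fst.comp measurable_snd)).ennreal_ofReal.mul (hR.comp hpair)

lemma measurable_mark_prodMk (l : ℕ) : Measurable fun p : Ω × (ℕ → V) => (p.2 l, p) :=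
  ((measurable_pi_apply l).comp measurable_snd).prodMk measurable_id

lemma tsum_measure_mark_point_rivalSup [SFinite P] [IsProbabilityMeasure Q]
    (hζ : ∀ i, Measurable (ζ i)) (hR : Measurable (Function.uncurry R))
    {K : Set (V × ℝ × ℝ≥0∞)} (hK : MeasurableSet K) :
    ∑' l, P.prod (Measure.infinitePi fun _ : ℕ => Q)
        {p | (p.2 l, ζ l p.1, rivalSup ζ (fun u => R u (p.2 l)) l p) ∈ K} =
      ∫⁻ v, pointRivalMeasure ζ (fun u => R u v) P Q (Prod.mk v ⁻¹' K) ∂Q := by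
  have hm : ∀ l, Measurable fun q : V × Ω × (ℕ → V) =>
      (q.1, ζ l q.2.1, rivalSup ζ (fun u => R u q.1) l q.2) := fun l =>
    measurable_fst.prodMk (((hζ l).comp (measurable_fst.comp measurable_snd)).prodMk
      (measurable_rivalSup_mark hζ hR l))
  calc ∑' l, P.prod (Measure.infinitePi fun _ : ℕ => Q)
        {p | (p.2 l, ζ l p.1, rivalSup ζ (fun u => R u (p.2 l)) l p) ∈ K}
      = ∑' l, ∫⁻ v, P.prod (Measure.infinitePi fun _ : ℕ => Q)
          {p | (v, ζ l p.1, rivalSup ζ (fun u => R u v) l p) ∈ K} ∂Q := by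
        refine tsum_congr fun l => ?_
        refine (prod_infinitePi_apply_update (fun _ : ℕ => Q) P l
          ((hm l).comp (measurable_mark_prodMk l) hK)).trans (lintegral_congr fun v => ?_)
        simp [rivalSup_update]
    _ = ∫⁻ v, ∑' l, P.prod (Measure.infinitePi fun _ : ℕ => Q)
          {p | (v, ζ l p.1, rivalSup ζ (fun u => R u v) l p) ∈ K} ∂Q :=
        (lintegral_tsum fun l => (measurable_measure_prodMk_left (hm l hK)).aemeasurable).symm
    _ = ∫⁻ v, pointRivalMeasure ζ (fun u => R u v) P Q (Prod.mk v ⁻¹' K) ∂Q :=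
        lintegral_congr fun v => (pointRivalMeasure_apply hζ (hR.comp measurable_prodMk_right)
          (measurable_prodMk_left hK)).symm

lemma tsum_measure_dominating [IsProbabilityMeasure Q]
    (h : IsPoissonProcess ζ inverseSquareMeasure P) (hR : Measurable (Function.uncurry R)) :
    ∑' l, P.prod (Measure.infinitePi fun _ : ℕ => Q) (dominating ζ R l) =
      ∫⁻ v, (∫⁻ u, R u v ∂Q)⁻¹ ∂Q := by
  have := h.isProbabilityMeasure
  refine (tsum_measure_mark_point_rivalSup h.measurable hR
    (K := {q | q.2.2 ≤ ENNReal.ofReal q.2.1}) (measurableSet_le (by fun_prop) (by fun_prop))).trans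
    (lintegral_congr fun v => ?_)
  exact pointRivalMeasure_setOf_le h (hR.comp measurable_prodMk_right)

lemma measure_rivalSup_eq_point [IsProbabilityMeasure Q]
    (h : IsPoissonProcess ζ inverseSquareMeasure P) (hR : Measurable (Function.uncurry R))
    (l : ℕ) :
    P.prod (Measure.infinitePi fun _ : ℕ => Q)
      {p | rivalSup ζ (fun u => R u (p.2 l)) l p = ENNReal.ofReal (ζ l p.1)} = 0 := by
  have := h.isProbabilityMeasure
  have hsum := tsum_measure_mark_point_rivalSup (P := P) (Q := Q) h.measurable hR
    (K := {q | q.2.2 = ENNReal.ofReal q.2.1}) (measurableSet_eq_fun (by fun_prop) (by fun_prop))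
  refine ENNReal.tsum_eq_zero.1 (hsum.trans (lintegral_eq_zero_of_ae_eq_zero ?_)) l
  exact ae_of_all _ fun v => pointRivalMeasure_setOf_eq h (hR.comp measurable_prodMk_right)

lemma measure_dominating_inter_lintegral_eq_top [IsProbabilityMeasure Q]
    (h : IsPoissonProcess ζ inverseSquareMeasure P) (hR : Measurable (Function.uncurry R))
    (l : ℕ) :
    P.prod (Measure.infinitePi fun _ : ℕ => Q)
      (dominating ζ R l ∩ {p | ∫⁻ u, R u (p.2 l) ∂Q = ∞}) = 0 := by
  have := h.isProbabilityMeasure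
  have hc : Measurable fun v => ∫⁻ u, R u v ∂Q := hR.lintegral_prod_left'
  have hsum := tsum_measure_mark_point_rivalSup (P := P) (Q := Q) h.measurable hR
    (K := {q | q.2.2 ≤ ENNReal.ofReal q.2.1} ∩ {q | ∫⁻ u, R u q.1 ∂Q = ∞})
    ((measurableSet_le (by fun_prop) (by fun_prop)).inter
      ((hc.comp measurable_fst) (measurableSet_singleton ∞)))
  refine ENNReal.tsum_eq_zero.1 (hsum.trans (lintegral_eq_zero_of_ae_eq_zero ?_)) l
  refine ae_of_all _ fun v => ?_
  by_cases hv : ∫⁻ u, R u v ∂Q = ∞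
  · refine measure_mono_null Set.inter_subset_left ?_
    exact (pointRivalMeasure_setOf_le h (hR.comp measurable_prodMk_right)).trans (by simp [hv])
  · exact measure_mono_null (fun q hq => (hv hq.2).elim) measure_empty

lemma aedisjoint_dominating [IsProbabilityMeasure Q]
    (h : IsPoissonProcess ζ inverseSquareMeasure P) (hR : Measurable (Function.uncurry R))
    (hRR : ∀ u v, ∫⁻ x, R x u ∂Q ≠ ∞ → ∫⁻ x, R x v ∂Q ≠ ∞ → 1 ≤ R u v * R v u) :
    Pairwise (Function.onFun (AEDisjoint (P.prod (Measure.infinitePi fun _ : ℕ => Q)))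
      (dominating ζ R)) := by
  intro l m hlm
  refine measure_mono_null (fun p hp => ?_) (measure_union_null
    (measure_rivalSup_eq_point (Q := Q) h hR m) (measure_union_null
      (measure_dominating_inter_lintegral_eq_top (Q := Q) h hR l)
      (measure_dominating_inter_lintegral_eq_top (Q := Q) h hR m)))
  by_contra hnot
  simp only [Set.mem_union, Set.mem_inter_iff, hp.1, hp.2, true_and, Set.mem_ofPred_eq,
    not_or] at hnot
  obtain ⟨htie, hl, hm⟩ := hnot
  have hlt : ENNReal.ofReal (ζ l p.1) * R (p.2 l) (p.2 m) < ENNReal.ofReal (ζ m p.1) :=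
    (rivalSup_le_iff.1 le_rfl l hlm).trans_lt (lt_of_le_of_ne hp.2 htie)
  have hle : ENNReal.ofReal (ζ m p.1) * R (p.2 m) (p.2 l) ≤ ENNReal.ofReal (ζ l p.1) :=
    rivalSup_le_iff.1 hp.1 m hlm.symm
  refine hlt.not_ge ?_
  calc ENNReal.ofReal (ζ m p.1)
      ≤ ENNReal.ofReal (ζ m p.1) * (R (p.2 m) (p.2 l) * R (p.2 l) (p.2 m)) :=
        le_mul_of_one_le_right' (hRR _ _ hm hl)
    _ ≤ ENNReal.ofReal (ζ l p.1) * R (p.2 l) (p.2 m) := by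
        rw [← mul_assoc]
        gcongr

theorem measure_iUnion_dominating [IsProbabilityMeasure Q]
    (h : IsPoissonProcess ζ inverseSquareMeasure P) (hR : Measurable (Function.uncurry R))
    (hRR : ∀ u v, ∫⁻ x, R x u ∂Q ≠ ∞ → ∫⁻ x, R x v ∂Q ≠ ∞ → 1 ≤ R u v * R v u) :
    P.prod (Measure.infinitePi fun _ : ℕ => Q) (⋃ l, dominating ζ R l) =
      ∫⁻ v, (∫⁻ u, R u v ∂Q)⁻¹ ∂Q := by
  have hmeas : ∀ l, MeasurableSet (dominating ζ R l) := fun l => by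
    refine measurableSet_le ?_ ((h.measurable l).comp measurable_fst).ennreal_ofReal
    exact (measurable_rivalSup_mark h.measurable hR l).comp (measurable_mark_prodMk l)
  rw [measure_iUnion₀ (aedisjoint_dominating h hR hRR) fun l => (hmeas l).nullMeasurableSet,
    tsum_measure_dominating h hR]

end Dominating

section MaxRatio

variable {ι : Type*}

/-- The largest of the ratios `u j / v j` of the coordinates of two nonnegative vectors, with
`a / 0 = ∞` for `a > 0` and `0 / 0 = 0`. -/
noncomputable def maxRatio (u v : ι → ℝ) : ℝ≥0∞ :=
  ⨆ j, ENNReal.ofReal (u j) / ENNReal.ofReal (v j)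

lemma measurable_maxRatio [Countable ι] :
    Measurable (Function.uncurry (maxRatio : (ι → ℝ) → (ι → ℝ) → ℝ≥0∞)) := by
  unfold maxRatio Function.uncurry
  fun_prop

lemma ofReal_mul_maxRatio_le_ofReal_iff {a b : ℝ} (ha : 0 ≤ a) (hb : 0 < b) {u v : ι → ℝ}
    (hv : 0 ≤ v) :
    ENNReal.ofReal a * maxRatio u v ≤ ENNReal.ofReal b ↔ a • u ≤ b • v := by
  rw [maxRatio, ENNReal.mul_iSup, iSup_le_iff, Pi.le_def]
  refine forall_congr' fun j => ?_
  rw [← mul_div_assoc, ENNReal.div_le_iff_le_mul (.inr ENNReal.ofReal_ne_top)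
    (.inl ENNReal.ofReal_ne_top), ← ENNReal.ofReal_mul ha, ← ENNReal.ofReal_mul hb.le,
    ENNReal.ofReal_le_ofReal_iff (mul_nonneg hb.le (hv j))]
  rfl

lemma one_le_maxRatio_mul_maxRatio {u v : ι → ℝ} {j : ι} (hu : 0 < u j) (hv : 0 < v j) :
    1 ≤ maxRatio u v * maxRatio v u := by
  have hratio : ENNReal.ofReal (u j) / ENNReal.ofReal (v j) *
      (ENNReal.ofReal (v j) / ENNReal.ofReal (u j)) = 1 := by
    rw [← ENNReal.ofReal_div_of_pos hv, ← ENNReal.ofReal_div_of_pos hu,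
      ← ENNReal.ofReal_mul (div_nonneg hu.le hv.le), div_mul_div_cancel₀ hv.ne', div_self hu.ne',
      ENNReal.ofReal_one]
  rw [← hratio]
  exact mul_le_mul' (le_iSup (fun j => ENNReal.ofReal (u j) / ENNReal.ofReal (v j)) j)
    (le_iSup (fun j => ENNReal.ofReal (v j) / ENNReal.ofReal (u j)) j)

lemma pos_of_lintegral_maxRatio_ne_top [Countable ι] {Q : Measure (ι → ℝ)} {v : ι → ℝ} {j : ι}
    (hpos : Q {u | 0 < u j} ≠ 0) (h : ∫⁻ u, maxRatio u v ∂Q ≠ ∞) : 0 < v j := by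
  by_contra! hv
  refine h (lintegral_eq_top_of_measure_eq_top_ne_zero
    (measurable_maxRatio.comp measurable_prodMk_right).aemeasurable fun hzero => hpos ?_)
  refine measure_mono_null (fun u (hu : 0 < u j) => top_unique ?_) hzero
  calc ∞ = ENNReal.ofReal (u j) / ENNReal.ofReal (v j) := by
        rw [ENNReal.ofReal_of_nonpos hv, ENNReal.div_zero (ENNReal.ofReal_pos.2 hu).ne']
    _ ≤ maxRatio u v := le_iSup (fun j => ENNReal.ofReal (u j) / ENNReal.ofReal (v j)) j

end MaxRatio

section Marks

lemma identDistrib_prodMk_infinitePi {ι Ω E F : Type*} [Countable ι] [MeasurableSpace Ω]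
    [MeasurableSpace E] [MeasurableSpace F] {P : Measure Ω} [IsProbabilityMeasure P]
    {Q : Measure F} [IsProbabilityMeasure Q] {Z : Ω → E} {X : ι → Ω → F} (hZ : AEMeasurable Z P)
    (hX : ∀ i, HasLaw (X i) Q P) (hX_indep : iIndepFun X P)
    (hZX : IndepFun Z (fun ω i => X i ω) P) :
    IdentDistrib (fun ω => (Z ω, fun i => X i ω)) (fun p => (Z p.1, p.2)) P
      (P.prod (Measure.infinitePi fun _ : ι => Q)) := by
  have hlaw : HasLaw Z (P.map Z) P := ⟨hZ, rfl⟩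
  have hlaw_pi := hX_indep.hasLaw_infinitePi hX
    (aemeasurable_pi_iff.2 fun i => (hX i).aemeasurable)
  refine (hZX.hasLaw_prod hlaw hlaw_pi).identDistrib ?_
  exact (indepFun_prod₀ hZ aemeasurable_id).hasLaw_prod
    (hlaw.fun_comp measurePreserving_fst.hasLaw) measurePreserving_snd.hasLaw

variable {ι Ω : Type*} [Countable ι] [MeasurableSpace Ω] {P : Measure Ω} {ζ : ℕ → Ω → ℝ}
  {Q : Measure (ι → ℝ)} [IsProbabilityMeasure Q]

lemma prod_infinitePi_exists_smul_le_smul (h : IsPoissonProcess ζ inverseSquareMeasure P)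
    (hnonneg : ∀ᵐ u ∂Q, 0 ≤ u) {j : ι} (hpos : Q {u | 0 < u j} ≠ 0) :
    P.prod (Measure.infinitePi fun _ : ℕ => Q)
        {p | ∃ l, ∀ i, ζ i p.1 • p.2 i ≤ ζ l p.1 • p.2 l} =
      ∫⁻ v, (∫⁻ u, maxRatio u v ∂Q)⁻¹ ∂Q := by
  have := h.isProbabilityMeasure
  have hpoints : ∀ᵐ p ∂P.prod (Measure.infinitePi fun _ : ℕ => Q), ∀ i, 0 < ζ i p.1 :=
    Measure.quasiMeasurePreserving_fst.ae (h.ae_forall ae_inverseSquareMeasure_pos)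
  have hmarks : ∀ᵐ p ∂P.prod (Measure.infinitePi fun _ : ℕ => Q), ∀ i, 0 ≤ p.2 i :=
    Measure.quasiMeasurePreserving_snd.ae (ae_all_iff.2 fun i =>
      (measurePreserving_eval_infinitePi (fun _ : ℕ => Q) i).quasiMeasurePreserving.ae hnonneg)
  rw [← measure_iUnion_dominating h measurable_maxRatio fun u v hu hv =>
    one_le_maxRatio_mul_maxRatio (pos_of_lintegral_maxRatio_ne_top hpos hu)
      (pos_of_lintegral_maxRatio_ne_top hpos hv)]
  refine measure_congr ?_
  filter_upwards [hpoints, hmarks] with p hζ hw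
  refine propext ((exists_congr fun l => ?_).trans Set.mem_iUnion.symm)
  refine Iff.trans ⟨fun hl i _ => ?_, fun hl i => ?_⟩ rivalSup_le_iff.symm
  · exact (ofReal_mul_maxRatio_le_ofReal_iff (hζ i).le (hζ l) (hw l)).2 (hl i)
  · obtain rfl | hil := eq_or_ne i l
    · exact le_rfl
    · exact (ofReal_mul_maxRatio_le_ofReal_iff (hζ i).le (hζ l) (hw l)).1 (hl i hil)

lemma measure_exists_smul_le_smul_of_hasLaw (h : IsPoissonProcess ζ inverseSquareMeasure P)
    {X : ℕ → Ω → ι → ℝ} (hX : ∀ i, HasLaw (X i) Q P) (hX_indep : iIndepFun X P)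
    (hζX : IndepFun (fun ω i => ζ i ω) (fun ω i => X i ω) P) (hnonneg : ∀ᵐ u ∂Q, 0 ≤ u) {j : ι}
    (hpos : Q {u | 0 < u j} ≠ 0) :
    P {ω | ∃ l, ∀ i, ζ i ω • X i ω ≤ ζ l ω • X l ω} = ∫⁻ v, (∫⁻ u, maxRatio u v ∂Q)⁻¹ ∂Q := by
  have := h.isProbabilityMeasure
  have hmeas : MeasurableSet {q : (ℕ → ℝ) × (ℕ → ι → ℝ) | ∃ l, ∀ i,
      q.1 i • q.2 i ≤ q.1 l • q.2 l} := by
    have hm : ∀ i, Measurable fun q : (ℕ → ℝ) × (ℕ → ι → ℝ) => q.1 i • q.2 i := by fun_prop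
    simp only [Set.ofPred_exists, Set.ofPred_forall]
    exact .iUnion fun l => .iInter fun i => measurableSet_le (hm i) (hm l)
  rw [← prod_infinitePi_exists_smul_le_smul h hnonneg hpos]
  exact (identDistrib_prodMk_infinitePi (measurable_pi_iff.2 h.measurable).aemeasurable hX hX_indep
    hζX).measure_mem_eq hmeas

theorem measure_exists_smul_le_smul {Ω₁ Ω₂ : Type*} [MeasurableSpace Ω₁] [MeasurableSpace Ω₂]
    {P₁ : Measure Ω₁} {P₂ : Measure Ω₂} (h : IsPoissonProcess ζ inverseSquareMeasure P)
    {X : ℕ → Ω → ι → ℝ} {X₁ : Ω₁ → ι → ℝ} {X₂ : Ω₂ → ι → ℝ}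
    (hX : ∀ i, IdentDistrib (X i) X₁ P P₁) (hX₂ : IdentDistrib X₂ X₁ P₂ P₁)
    (hX_indep : iIndepFun X P) (hζX : IndepFun (fun ω i => ζ i ω) (fun ω i => X i ω) P)
    (hnonneg : ∀ᵐ ω ∂P₁, 0 ≤ X₁ ω) {j : ι} (hpos : P₁ {ω | 0 < X₁ ω j} ≠ 0) :
    P {ω | ∃ l, ∀ i, ζ i ω • X i ω ≤ ζ l ω • X l ω} =
      ∫⁻ ω₁, (∫⁻ ω₂, maxRatio (X₂ ω₂) (X₁ ω₁) ∂P₂)⁻¹ ∂P₁ := by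
  have := h.isProbabilityMeasure
  have hlaw₁ : HasLaw X₁ (P₁.map X₁) P₁ := ⟨hX₂.aemeasurable_snd, rfl⟩
  have hlaw₂ : HasLaw X₂ (P₁.map X₁) P₂ := hX₂.symm.hasLaw hlaw₁
  have hlaw : ∀ i, HasLaw (X i) (P₁.map X₁) P := fun i => (hX i).symm.hasLaw hlaw₁
  have := (hlaw 0).isProbabilityMeasure_iff.1 inferInstance
  have hnonneg' : ∀ᵐ u ∂P₁.map X₁, 0 ≤ u :=
    (ae_map_iff hlaw₁.aemeasurable (measurableSet_le measurable_const measurable_id)).2 hnonneg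
  have hpos' : P₁.map X₁ {u | 0 < u j} ≠ 0 := by
    rwa [← hlaw₁.measure_eq (measurableSet_lt measurable_const (measurable_pi_apply j))]
  have hR := measurable_maxRatio (ι := ι)
  calc P {ω | ∃ l, ∀ i, ζ i ω • X i ω ≤ ζ l ω • X l ω}
      = ∫⁻ v, (∫⁻ u, maxRatio u v ∂P₁.map X₁)⁻¹ ∂P₁.map X₁ :=
        measure_exists_smul_le_smul_of_hasLaw h hlaw hX_indep hζX hnonneg' hpos'
    _ = ∫⁻ ω₁, (∫⁻ u, maxRatio u (X₁ ω₁) ∂P₁.map X₁)⁻¹ ∂P₁ :=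
        (hlaw₁.lintegral_comp hR.lintegral_prod_left'.inv.aemeasurable).symm
    _ = ∫⁻ ω₁, (∫⁻ ω₂, maxRatio (X₂ ω₂) (X₁ ω₁) ∂P₂)⁻¹ ∂P₁ :=
        lintegral_congr fun ω₁ => congrArg Inv.inv
          (hlaw₂.lintegral_comp (hR.comp measurable_prodMk_right).aemeasurable).symm

end Marks

section ConcurrenceProbability

variable {Ω T : Type*} {ζ : ℕ → Ω → ℝ} {Ys : ℕ → Ω → T → ℝ}

lemma maxStable_eq_spectralFunction_iff {l : ℕ} {ω : Ω} {t : T} :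
    maxStable ζ Ys ω t = (spectralFunction ζ Ys l ω t : EReal) ↔
      ∀ i, ζ i ω * Ys i ω t ≤ ζ l ω * Ys l ω t := by
  have hle : (spectralFunction ζ Ys l ω t : EReal) ≤ maxStable ζ Ys ω t :=
    le_iSup (fun i => (spectralFunction ζ Ys i ω t : EReal)) l
  rw [← hle.ge_iff_eq', maxStable, iSup_le_iff]
  exact forall_congr' fun i => EReal.coe_le_coe_iff

lemma extremalConcurrenceProb_eq_measure_exists_smul_le_smul [MeasurableSpace Ω] (P : Measure Ω)
    {k : ℕ} (s : Fin k → T) :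
    extremalConcurrenceProb ζ Ys P s =
      P {ω | ∃ l, ∀ i, ζ i ω • (fun j => Ys i ω (s j)) ≤ ζ l ω • fun j => Ys l ω (s j)} := by
  simp only [extremalConcurrenceProb, maxStable_eq_spectralFunction_iff]
  exact congrArg P (Set.ext fun ω => exists_congr fun l => forall_comm)

variable [MeasurableSpace Ω] {P : Measure Ω}

lemma IsSpectralProcess.measure_pos_ne_zero [TopologicalSpace T] {Y : Ω → T → ℝ}
    (h : IsSpectralProcess Y P) (t : T) : P {ω | 0 < Y ω t} ≠ 0 := by
  intro hzero
  have hY : ∫ ω, Y ω t ∂P = 0 := integral_eq_zero_of_ae <| by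
    filter_upwards [measure_eq_zero_iff_ae_notMem.1 hzero] with ω hω
    exact le_antisymm (not_lt.1 hω) (h.nonneg ω t)
  exact zero_ne_one (hY.symm.trans (h.mean_one t))

end ConcurrenceProbability

end Concurrence

theorem theorem2_general {T Ω Ω₁ Ω₂ : Type*} [MeasurableSpace Ω] [MeasurableSpace Ω₁]
    [MeasurableSpace Ω₂] {P : Measure Ω} {P₁ : Measure Ω₁} {P₂ : Measure Ω₂}
    {Y : Ω₁ → T → ℝ} {Ytilde : Ω₂ → T → ℝ} (hcopy : IdentDistrib Ytilde Y P₂ P₁)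
    {ζ : ℕ → Ω → ℝ} {Ys : ℕ → Ω → T → ℝ}
    (hζ : Concurrence.IsPoissonProcess ζ Concurrence.inverseSquareMeasure P)
    (hYs : ∀ i, IdentDistrib (Ys i) Y P P₁) (hYs_indep : iIndepFun Ys P)
    (hζYs : IndepFun (fun ω i => ζ i ω) (fun ω i => Ys i ω) P)
    {k : ℕ} {s : Fin k → T} (hnonneg : ∀ j, ∀ᵐ ω ∂P₁, 0 ≤ Y ω (s j)) {j₀ : Fin k}
    (hpos : P₁ {ω | 0 < Y ω (s j₀)} ≠ 0) :
    Concurrence.extremalConcurrenceProb ζ Ys P s =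
      ∫⁻ ω₁, (∫⁻ ω₂, ⨆ j, ENNReal.ofReal (Ytilde ω₂ (s j)) / ENNReal.ofReal (Y ω₁ (s j))
        ∂P₂)⁻¹ ∂P₁ := by
  have hs : Measurable fun (y : T → ℝ) j => y (s j) :=
    measurable_pi_iff.2 fun j => measurable_pi_apply (s j)
  have hs' : Measurable fun (y : ℕ → T → ℝ) i j => y i (s j) :=
    measurable_pi_iff.2 fun i => hs.comp (measurable_pi_apply i)
  rw [Concurrence.extremalConcurrenceProb_eq_measure_exists_smul_le_smul]
  exact Concurrence.measure_exists_smul_le_smul hζ (fun i => (hYs i).comp hs) (hcopy.comp hs)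
    (hYs_indep.comp _ fun _ => hs) (hζYs.comp measurable_id hs') (ae_all_iff.2 hnonneg) hpos

/-- Expectations and quotients on the right-hand side are taken in `[0, ∞]`, where `a / 0 = ∞` for
`a > 0` and `∞⁻¹ = 0`. `Y` and `Ytilde` have the same law and live on separate probability spaces,
so that they are independent copies of each other on the product space. -/
theorem theorem2 {d : ℕ} (X : Set (EuclideanSpace ℝ (Fin d))) (hX : IsCompact X)
    {Ω Ω₁ Ω₂ : Type*} [MeasurableSpace Ω] [MeasurableSpace Ω₁] [MeasurableSpace Ω₂]
    (P : Measure Ω) [IsProbabilityMeasure P]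
    (P₁ : Measure Ω₁) [IsProbabilityMeasure P₁]
    (P₂ : Measure Ω₂) [IsProbabilityMeasure P₂]
    (Y : Ω₁ → X → ℝ) (hY : Concurrence.IsSpectralProcess Y P₁)
    (Ytilde : Ω₂ → X → ℝ) (hYtilde : Concurrence.IsSpectralProcess Ytilde P₂)
    (hcopy : IdentDistrib Ytilde Y P₂ P₁)
    (ζ : ℕ → Ω → ℝ) (Ys : ℕ → Ω → X → ℝ)
    (hrep : Concurrence.IsSpectralRepresentation ζ Ys P Y P₁)
    {k : ℕ} (hk : 2 ≤ k) (s : Fin k → X) :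
    Concurrence.extremalConcurrenceProb ζ Ys P s =
      ∫⁻ ω₁, (∫⁻ ω₂, ⨆ j, ENNReal.ofReal (Ytilde ω₂ (s j)) / ENNReal.ofReal (Y ω₁ (s j))
        ∂P₂)⁻¹ ∂P₁ :=
  theorem2_general hcopy hrep.poisson hrep.identDistrib hrep.iIndep hrep.indep
    (fun j => ae_of_all _ fun ω => hY.nonneg ω (s j))
    (hY.measure_pos_ne_zero (s ⟨0, by lia⟩))
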